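/- A \emph{permutation} is a finite set equipped with two linear orders $<_1$ and $<_2$; its \emph{size} is its number of points, and an \emph{embedding} of permutations is an injection preserving and reflecting both orders. Let $M$ be an $m\times n$ matrix with entries in $\{0,1,-1\}$, and write $|M| = mn$ for its number of entries. The \emph{standard figure} of $M$ is the subset of the plane obtained by drawing, in an $m\times n$ grid of unit squares whose cells correspond to the entries of $M$ (rows numbered from bottom to top, columns from left to right), the open line segment from the bottom left to the top right corner of every cell with entry $1$, the open line segment from the top left to the bottom right corner of every cell with entry $-1$, and nothing in the cells with entry $0$. The \emph{geometric grid class} $\mathrm{Geom}(M)$ is the set of all permutations that can be represented by a finite set of points of the standard figure, no two of which share an $x$- or a $y$-coordinate, where $<_1$ is the left-to-right order and $<_2$ is the bottom-to-top order of the points. The \emph{basis} of $\mathrm{Geom}(M)$ is the set of embedding-minimal permutations not contained in $\mathrm{Geom}(M)$. \textbf{Proposition.} There is a computable function $f\colon\mathbb{N}\to\mathbb{N}$ such that, for every finite matrix $M$ with entries in $\{0,1,-1\}$, every basis element of $\mathrm{Geom}(M)$ has size at most $f(|M|)$. -/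

import Mathlib

/-- A (finite) permutation: a finite set equipped with two strict linear orders.  The first
is the left-to-right order, the second is the bottom-to-top order. -/
structure Permutation where
  carrier : Type
  finite : Finite carrier
  lt₁ : carrier → carrier → Prop
  lt₂ : carrier → carrier → Prop
  strictTotal₁ : IsStrictTotalOrder carrier lt₁
  strictTotal₂ : IsStrictTotalOrder carrier lt₂

namespace Permutation

/-- The size (length) of a permutation is its number of points. -/
noncomputable def size (π : Permutation) : ℕ := Nat.card π.carrier

/-- `Embeds σ π`: there is an embedding of `σ` into `π`, as structures with two orders
(that is, `σ` is contained in `π`). -/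
def Embeds (σ π : Permutation) : Prop :=
  ∃ e : σ.carrier ↪ π.carrier,
    (∀ x y, π.lt₁ (e x) (e y) ↔ σ.lt₁ x y) ∧ (∀ x y, π.lt₂ (e x) (e y) ↔ σ.lt₂ x y)

/-- `π` can be drawn on `S ⊆ ℝ²`: it is represented by points of `S`, where `lt₁` is the
left-to-right and `lt₂` the bottom-to-top order of the points.  As both orders are total,
no two of the points share a coordinate. -/
def DrawnOn (π : Permutation) (S : Set (ℝ × ℝ)) : Prop :=
  ∃ p : π.carrier → ℝ × ℝ, (∀ x, p x ∈ S) ∧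
    (∀ x y, π.lt₁ x y ↔ (p x).1 < (p y).1) ∧ (∀ x y, π.lt₂ x y ↔ (p x).2 < (p y).2)

/-- The basis of a class of permutations: the embedding-minimal permutations that are not
in the class. (Basis elements are not identified up to isomorphism.) -/
def basis (C : Set Permutation) : Set Permutation :=
  {π | π ∉ C ∧ ∀ σ : Permutation, σ ∉ C → σ.Embeds π → π.Embeds σ}

end Permutation

/-- The open line segment drawn in the unit cell with lower left corner `(a, b)`, according
to the matrix entry `s`. -/
def cellSegment (s : SignType) (a b : ℝ) : Set (ℝ × ℝ) :=
  match s with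
  | SignType.zero => ∅
  | SignType.pos => openSegment ℝ (a, b) (a + 1, b + 1)
  | SignType.neg => openSegment ℝ (a, b + 1) (a + 1, b)

/-- The standard figure of a `0/±1`-matrix: the entry in row `i` and column `j` belongs to
the unit cell `[j, j + 1] × [i, i + 1]`, so rows are numbered from bottom to top. -/
def standardFigure {m n : ℕ} (M : Matrix (Fin m) (Fin n) SignType) : Set (ℝ × ℝ) :=
  ⋃ (i : Fin m) (j : Fin n), cellSegment (M i j) ((j : ℕ) : ℝ) ((i : ℕ) : ℝ)

/-- The geometric grid class of `M`: the permutations that can be drawn on the standard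
figure of `M`. -/
def Geom {m n : ℕ} (M : Matrix (Fin m) (Fin n) SignType) : Set Permutation :=
  {π | π.DrawnOn (standardFigure M)}

open Relation

/-- The quarters of the cells of an `m × n` grid: row, column, whether it is in the right half of
the column, and whether it is in the upper half of the row. -/
abbrev Quarter (m n : ℕ) : Type := Fin m × Fin n × Bool × Bool

/-! ### Coordinates on the quarters of the figure -/

namespace Quarter

variable {m n : ℕ}

/-- The index of the half-column of a quarter. -/
def xPos (c : Quarter m n) : ℕ := 2 * c.2.1 + c.2.2.1.toNat

/-- The index of the half-row of a quarter. -/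
def yPos (c : Quarter m n) : ℕ := 2 * c.1 + c.2.2.2.toNat

/-- The standard figure of `M` meets the quarter `c`. -/
def Fits (M : Matrix (Fin m) (Fin n) SignType) (c : Quarter m n) : Prop :=
  (M c.1 c.2.1 = SignType.pos ∧ c.2.2.1 = c.2.2.2) ∨
    (M c.1 c.2.1 = SignType.neg ∧ c.2.2.1 ≠ c.2.2.2)

/-- The coordinate of the point at distance `e` from the centre of the unit interval starting
at `j`, to the right of the centre if `h` holds and to the left otherwise. -/
noncomputable def coord (j : ℕ) (h : Bool) (e : ℝ) : ℝ := j + 1 / 2 + if h then e else -e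

/-- Positivity matters: at distance 0 the two halves of a cell meet. This is why drawings are
rebuilt with positive distances, although a given drawing may use 0. -/
theorem coord_lt_of_lt {j j' : ℕ} {h h' : Bool} {e e' : ℝ} (he : 0 < e) (he2 : e < 1 / 2)
    (he' : 0 < e') (he2' : e' < 1 / 2) (hlt : 2 * j + h.toNat < 2 * j' + h'.toNat) :
    coord j h e < coord j' h' e' := by
  rcases lt_or_ge j j' with hj | hj
  · have : (j : ℝ) + 1 ≤ j' := by exact_mod_cast hj
    unfold coord
    split_ifs <;> linarith
  · cases h <;> cases h' <;> simp at hlt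
    · omega
    · have : j = j' := by omega
      subst this
      simp [coord]; linarith
    · omega
    · omega

theorem le_of_coord_lt {j j' : ℕ} {h h' : Bool} {e e' : ℝ} (he : 0 ≤ e) (he2 : e < 1 / 2)
    (he' : 0 ≤ e') (he2' : e' < 1 / 2) (hlt : coord j h e < coord j' h' e') :
    2 * j + h.toNat ≤ 2 * j' + h'.toNat := by
  rcases lt_trichotomy j j' with hj | hj | hj
  · cases h <;> cases h' <;> simp <;> omega
  · subst hj
    cases h <;> cases h' <;> simp [coord] at hlt ⊢
    linarith
  · have : (j' : ℝ) + 1 ≤ j := by exact_mod_cast hj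
    unfold coord at hlt
    split_ifs at hlt <;> linarith

theorem eq_of_pos_eq {j j' : ℕ} {h h' : Bool} (heq : 2 * j + h.toNat = 2 * j' + h'.toNat) :
    j = j' ∧ h = h' := by
  cases h <;> cases h' <;> simp at heq ⊢ <;> omega

theorem coord_lt_iff {j : ℕ} {h : Bool} {e e' : ℝ} :
    coord j h e < coord j h e' ↔ if h then e < e' else e' < e := by
  cases h
  · simp only [coord, Bool.false_eq_true, if_false]
    constructor <;> intro h <;> linarith
  · simp [coord]

end Quarter

open Quarter

theorem exists_quarter_of_mem_cellSegment {m n : ℕ} (M : Matrix (Fin m) (Fin n) SignType)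
    (i : Fin m) (j : Fin n) (p : ℝ × ℝ)
    (hp : p ∈ cellSegment (M i j) ((j : ℕ) : ℝ) ((i : ℕ) : ℝ)) :
    ∃ (c : Quarter m n) (e : ℝ), Fits M c ∧ 0 ≤ e ∧ e < 1 / 2 ∧
      p.1 = coord c.2.1 c.2.2.1 e ∧ p.2 = coord c.1 c.2.2.2 e := by
  have hcase : ∀ s, M i j = s → p ∈ cellSegment s ((j : ℕ) : ℝ) ((i : ℕ) : ℝ) →
      ∃ (c : Quarter m n) (e : ℝ), Fits M c ∧ 0 ≤ e ∧ e < 1 / 2 ∧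
      p.1 = coord c.2.1 c.2.2.1 e ∧ p.2 = coord c.1 c.2.2.2 e := by
    intro s hs hp
    cases s with
    | zero => simp [cellSegment] at hp
    | pos =>
      obtain ⟨u, t, hu, ht, hut, rfl⟩ := hp
      obtain rfl : u = 1 - t := by linarith
      rcases le_total (1 / 2) t with h | h
      · refine ⟨(i, j, true, true), t - 1 / 2, Or.inl ⟨hs, rfl⟩, by linarith, by linarith, ?_, ?_⟩
          <;> simp [coord] <;> ring
      · refine ⟨(i, j, false, false), 1 / 2 - t, Or.inl ⟨hs, rfl⟩, by linarith, by linarith,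
          ?_, ?_⟩ <;> simp [coord] <;> ring
    | neg =>
      obtain ⟨u, t, hu, ht, hut, rfl⟩ := hp
      obtain rfl : u = 1 - t := by linarith
      rcases le_total (1 / 2) t with h | h
      · refine ⟨(i, j, true, false), t - 1 / 2, Or.inr ⟨hs, by simp⟩, by linarith, by linarith,
          ?_, ?_⟩ <;> simp [coord] <;> ring
      · refine ⟨(i, j, false, true), 1 / 2 - t, Or.inr ⟨hs, by simp⟩, by linarith, by linarith,
          ?_, ?_⟩ <;> simp [coord] <;> ring
  exact hcase _ rfl hp

theorem mem_standardFigure_of_fits {m n : ℕ} {M : Matrix (Fin m) (Fin n) SignType}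
    {c : Quarter m n} (hc : Fits M c) {e : ℝ} (he : 0 ≤ e) (he2 : e < 1 / 2) :
    (coord c.2.1 c.2.2.1 e, coord c.1 c.2.2.2 e) ∈ standardFigure M := by
  obtain ⟨i, j, h, k⟩ := c
  simp only [standardFigure, Set.mem_iUnion]
  refine ⟨i, j, ?_⟩
  rcases hc with ⟨hs, hk⟩ | ⟨hs, hk⟩ <;> simp only at hs hk ⊢ <;> rw [hs]
  · subst hk
    cases h
    · refine ⟨1 / 2 + e, 1 / 2 - e, by linarith, by linarith, by ring, ?_⟩
      ext <;> simp [coord] <;> ring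
    · refine ⟨1 / 2 - e, 1 / 2 + e, by linarith, by linarith, by ring, ?_⟩
      ext <;> simp [coord] <;> ring
  · cases h <;> cases k <;> simp at hk
    · refine ⟨1 / 2 + e, 1 / 2 - e, by linarith, by linarith, by ring, ?_⟩
      ext <;> simp [coord] <;> ring
    · refine ⟨1 / 2 - e, 1 / 2 + e, by linarith, by linarith, by ring, ?_⟩
      ext <;> simp [coord] <;> ring

theorem rel_swap_iff_not {α : Type*} {r : α → α → Prop} (h : IsStrictTotalOrder α r) {x y : α}
    (hxy : x ≠ y) : r y x ↔ ¬ r x y := by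
  constructor
  · exact fun h1 h2 => irrefl_of r x (trans_of r h2 h1)
  · intro h1
    rcases trichotomous_of r x y with h2 | h2 | h2
    · exact absurd h2 h1
    · exact absurd h2 hxy
    · exact h2

/-! ### Deleting points from basis elements; drawings and griddings -/

namespace Permutation

/-- The permutation induced on a set of points. -/
def restrict (π : Permutation) (S : Set π.carrier) : Permutation where
  carrier := S
  finite := by have := π.finite; infer_instance
  lt₁ x y := π.lt₁ x y
  lt₂ x y := π.lt₂ x y
  strictTotal₁ := by
    have := π.strictTotal₁
    exact (Subrel.relEmbedding π.lt₁ (· ∈ S)).isStrictTotalOrder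
  strictTotal₂ := by
    have := π.strictTotal₂
    exact (Subrel.relEmbedding π.lt₂ (· ∈ S)).isStrictTotalOrder

theorem restrict_embeds (π : Permutation) (S : Set π.carrier) : (π.restrict S).Embeds π :=
  ⟨⟨Subtype.val, Subtype.val_injective⟩, fun _ _ => Iff.rfl, fun _ _ => Iff.rfl⟩

theorem not_embeds_restrict (π : Permutation) {S : Set π.carrier} {x : π.carrier} (hx : x ∉ S) :
    ¬ π.Embeds (π.restrict S) := by
  rintro ⟨e, -, -⟩
  have := π.finite
  have hinj : Function.Injective (Subtype.val ∘ e : π.carrier → π.carrier) :=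
    Subtype.val_injective.comp e.injective
  obtain ⟨y, rfl⟩ := Finite.surjective_of_injective hinj x
  exact hx (Subtype.property (p := (· ∈ S)) (e y))

theorem restrict_mem_of_mem_basis {C : Set Permutation} {π : Permutation} (hπ : π ∈ basis C)
    {S : Set π.carrier} {x : π.carrier} (hx : x ∉ S) : π.restrict S ∈ C := by
  by_contra h
  exact π.not_embeds_restrict hx (hπ.2 _ h (π.restrict_embeds S))

variable {m n : ℕ} {M : Matrix (Fin m) (Fin n) SignType} {π : Permutation}

/-- A drawing of `π` on the standard figure of `M`: the point `x` is in the quarter `c x`, at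
horizontal distance `e x` from the centre of its cell. -/
structure IsDrawing (M : Matrix (Fin m) (Fin n) SignType) (π : Permutation)
    (c : π.carrier → Quarter m n) (e : π.carrier → ℝ) : Prop where
  fits : ∀ x, Fits M (c x)
  nonneg : ∀ x, 0 ≤ e x
  lt_half : ∀ x, e x < 1 / 2
  lt₁_iff : ∀ x y, π.lt₁ x y ↔
    coord (c x).2.1 (c x).2.2.1 (e x) < coord (c y).2.1 (c y).2.2.1 (e y)
  lt₂_iff : ∀ x y, π.lt₂ x y ↔
    coord (c x).1 (c x).2.2.2 (e x) < coord (c y).1 (c y).2.2.2 (e y)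

theorem mem_geom_iff_exists_isDrawing :
    π ∈ Geom M ↔ ∃ c e, IsDrawing M π c e := by
  constructor
  · rintro ⟨p, hp, h₁, h₂⟩
    have : ∀ x, ∃ (c : Quarter m n) (e : ℝ), Fits M c ∧ 0 ≤ e ∧ e < 1 / 2 ∧
        (p x).1 = coord c.2.1 c.2.2.1 e ∧ (p x).2 = coord c.1 c.2.2.2 e := by
      intro x
      have hx := hp x
      simp only [standardFigure, Set.mem_iUnion] at hx
      obtain ⟨i, j, hij⟩ := hx
      exact exists_quarter_of_mem_cellSegment M i j _ hij
    choose c e hf h0 hh hx hy using this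
    refine ⟨c, e, hf, h0, hh, fun x y => ?_, fun x y => ?_⟩
    · rw [h₁, hx, hx]
    · rw [h₂, hy, hy]
  · rintro ⟨c, e, h⟩
    exact ⟨fun x => (coord (c x).2.1 (c x).2.2.1 (e x), coord (c x).1 (c x).2.2.2 (e x)),
      fun x => mem_standardFigure_of_fits (h.fits x) (h.nonneg x) (h.lt_half x), h.lt₁_iff,
      h.lt₂_iff⟩

/-- In a drawing by quarters `c`, the point `x` has to be closer to the centre of its cell
than `y`. -/
def Arc (π : Permutation) (c : π.carrier → Quarter m n) (x y : π.carrier) : Prop :=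
  (xPos (c x) = xPos (c y) ∧ if (c x).2.2.1 then π.lt₁ x y else π.lt₁ y x) ∨
    (yPos (c x) = yPos (c y) ∧ if (c x).2.2.2 then π.lt₂ x y else π.lt₂ y x)

/-- The relation `Arc` restricted to a set of points. -/
def ArcOn (π : Permutation) (S : Set π.carrier) (c : π.carrier → Quarter m n)
    (x y : π.carrier) : Prop :=
  x ∈ S ∧ y ∈ S ∧ π.Arc c x y

/-- An assignment of quarters to points which is realised on `S` by a drawing on the standard
figure of `M`. -/
structure IsGridding (M : Matrix (Fin m) (Fin n) SignType) (π : Permutation)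
    (S : Set π.carrier) (c : π.carrier → Quarter m n) : Prop where
  fits : ∀ x ∈ S, Fits M (c x)
  mono₁ : ∀ x ∈ S, ∀ y ∈ S, π.lt₁ x y → xPos (c x) ≤ xPos (c y)
  mono₂ : ∀ x ∈ S, ∀ y ∈ S, π.lt₂ x y → yPos (c x) ≤ yPos (c y)
  acyclic : ∀ x, ¬ TransGen (π.ArcOn S c) x x

theorem IsDrawing.lt₁_iff_of_xPos_eq {c : π.carrier → Quarter m n} {e : π.carrier → ℝ}
    (h : IsDrawing M π c e) {x y : π.carrier} (hxy : xPos (c x) = xPos (c y)) :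
    π.lt₁ x y ↔ if (c x).2.2.1 then e x < e y else e y < e x := by
  obtain ⟨h1, h2⟩ := eq_of_pos_eq hxy
  rw [h.lt₁_iff, ← h1, ← h2, coord_lt_iff]

theorem IsDrawing.lt₂_iff_of_yPos_eq {c : π.carrier → Quarter m n} {e : π.carrier → ℝ}
    (h : IsDrawing M π c e) {x y : π.carrier} (hxy : yPos (c x) = yPos (c y)) :
    π.lt₂ x y ↔ if (c x).2.2.2 then e x < e y else e y < e x := by
  obtain ⟨h1, h2⟩ := eq_of_pos_eq hxy
  rw [h.lt₂_iff, ← h1, ← h2, coord_lt_iff]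

theorem IsDrawing.xPos_le {c : π.carrier → Quarter m n} {e : π.carrier → ℝ}
    (h : IsDrawing M π c e) {x y : π.carrier} (hxy : π.lt₁ x y) : xPos (c x) ≤ xPos (c y) :=
  le_of_coord_lt (h.nonneg x) (h.lt_half x) (h.nonneg y) (h.lt_half y) ((h.lt₁_iff x y).1 hxy)

theorem IsDrawing.yPos_le {c : π.carrier → Quarter m n} {e : π.carrier → ℝ}
    (h : IsDrawing M π c e) {x y : π.carrier} (hxy : π.lt₂ x y) : yPos (c x) ≤ yPos (c y) :=
  le_of_coord_lt (h.nonneg x) (h.lt_half x) (h.nonneg y) (h.lt_half y) ((h.lt₂_iff x y).1 hxy)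

theorem IsDrawing.lt_of_arc {c : π.carrier → Quarter m n} {e : π.carrier → ℝ}
    (h : IsDrawing M π c e) {x y : π.carrier} (hxy : π.Arc c x y) : e x < e y := by
  rcases hxy with ⟨h1, h2⟩ | ⟨h1, h2⟩
  · have hb := (eq_of_pos_eq h1).2
    rw [h.lt₁_iff_of_xPos_eq h1, h.lt₁_iff_of_xPos_eq h1.symm, ← hb] at h2
    split_ifs at h2 <;> assumption
  · have hb := (eq_of_pos_eq h1).2
    rw [h.lt₂_iff_of_yPos_eq h1, h.lt₂_iff_of_yPos_eq h1.symm, ← hb] at h2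
    split_ifs at h2 <;> assumption

theorem exists_isGridding_of_restrict_mem_geom [Nonempty (Quarter m n)] {S : Set π.carrier}
    (hS : π.restrict S ∈ Geom M) : ∃ c, IsGridding M π S c := by
  classical
  obtain ⟨c, e, h⟩ := mem_geom_iff_exists_isDrawing.1 hS
  let d : π.carrier → Quarter m n := fun x => if hx : x ∈ S then c ⟨x, hx⟩ else Classical.arbitrary _
  let e' : π.carrier → ℝ := fun x => if hx : x ∈ S then e ⟨x, hx⟩ else 0
  have hd : ∀ x : S, d x = c x := fun x => by simp [d]
  have he : ∀ x : S, e' x = e x := fun x => by simp [e']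
  refine ⟨d, fun x hx => ?_, fun x hx y hy hxy => ?_, fun x hx y hy hxy => ?_, fun x hx => ?_⟩
  · rw [hd ⟨x, hx⟩]; exact h.fits _
  · rw [hd ⟨x, hx⟩, hd ⟨y, hy⟩]
    exact h.xPos_le hxy
  · rw [hd ⟨x, hx⟩, hd ⟨y, hy⟩]
    exact h.yPos_le hxy
  · have key : ∀ y z, π.ArcOn S d y z → e' y < e' z := by
      rintro y z ⟨hy, hz, hyz⟩
      rw [he ⟨y, hy⟩, he ⟨z, hz⟩]
      apply h.lt_of_arc
      unfold Arc at hyz ⊢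
      rw [hd ⟨y, hy⟩, hd ⟨z, hz⟩] at hyz
      exact hyz
    have : TransGen (· < ·) (e' x) (e' x) := hx.lift e' key
    rw [transGen_eq_self] at this
    exact lt_irrefl _ this

theorem exists_rank_of_acyclic {α : Type*} [Finite α] {r : α → α → Prop}
    (h : ∀ x, ¬ TransGen r x x) :
    ∃ e : α → ℝ, (∀ x, 0 < e x) ∧ (∀ x, e x < 1 / 2) ∧ ∀ x y, r x y → e x < e y := by
  let k : α → ℕ := fun x => {y | TransGen r y x}.ncard
  have hk : ∀ x, k x ≤ Nat.card α := fun x => Set.ncard_le_card _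
  have hN : (0 : ℝ) < 2 * (Nat.card α + 2) := by positivity
  -- The rank counts the strict predecessors, at most `Nat.card α`; the shifts by 1 and 2 keep the
  -- value strictly between 0 and 1/2.
  refine ⟨fun x => (k x + 1) / (2 * (Nat.card α + 2)), fun x => by positivity, fun x => ?_,
    fun x y hxy => ?_⟩
  · rw [div_lt_div_iff₀ hN two_pos]
    have : (k x : ℝ) ≤ Nat.card α := by exact_mod_cast hk x
    linarith
  · have : k x < k y := by
      apply Set.ncard_lt_ncard _ (Set.toFinite _)
      refine ⟨fun z (hz : TransGen r z x) => hz.tail hxy, fun hsub => ?_⟩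
      exact h x (hsub (TransGen.single hxy))
    have : (k x : ℝ) < k y := by exact_mod_cast this
    exact div_lt_div_of_pos_right (by linarith) hN

/-- Acyclicity yields distances that increase along arcs. These order the points inside each
half-column and half-row, and monotonicity orders points in different ones. -/
theorem IsGridding.mem_geom {c : π.carrier → Quarter m n} (h : IsGridding M π Set.univ c) :
    π ∈ Geom M := by
  have := π.finite
  obtain ⟨e, he, he2, hr⟩ := exists_rank_of_acyclic h.acyclic
  have iff_of_imp : ∀ {r : π.carrier → π.carrier → Prop} (_ : IsStrictTotalOrder _ r)
      {f : π.carrier → ℝ} (_ : ∀ x y, r x y → f x < f y) (x y), r x y ↔ f x < f y := by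
    intro r hr f hf x y
    refine ⟨hf x y, fun hxy => ?_⟩
    by_contra hn
    rcases eq_or_ne x y with rfl | hne
    · exact lt_irrefl _ hxy
    · exact lt_asymm hxy (hf y x ((rel_swap_iff_not hr hne).2 hn))
  refine mem_geom_iff_exists_isDrawing.2 ⟨c, e, fun x => h.fits x trivial, fun x => (he x).le, he2,
    ?_, ?_⟩
  · refine iff_of_imp π.strictTotal₁ fun x y hxy => ?_
    rcases (h.mono₁ x trivial y trivial hxy).lt_or_eq with hlt | heq
    · exact coord_lt_of_lt (he x) (he2 x) (he y) (he2 y) hlt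
    · obtain ⟨h1, h2⟩ := eq_of_pos_eq heq
      rw [← h1, ← h2, coord_lt_iff]
      split_ifs with hb
      · exact hr x y ⟨trivial, trivial, Or.inl ⟨heq, by rwa [if_pos hb]⟩⟩
      · exact hr y x ⟨trivial, trivial, Or.inl ⟨heq.symm, by rwa [if_neg (h2 ▸ hb)]⟩⟩
  · refine iff_of_imp π.strictTotal₂ fun x y hxy => ?_
    rcases (h.mono₂ x trivial y trivial hxy).lt_or_eq with hlt | heq
    · exact coord_lt_of_lt (he x) (he2 x) (he y) (he2 y) hlt
    · obtain ⟨h1, h2⟩ := eq_of_pos_eq heq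
      rw [← h1, ← h2, coord_lt_iff]
      split_ifs with hb
      · exact hr x y ⟨trivial, trivial, Or.inr ⟨heq, by rwa [if_pos hb]⟩⟩
      · exact hr y x ⟨trivial, trivial, Or.inr ⟨heq.symm, by rwa [if_neg (h2 ▸ hb)]⟩⟩

/-! ### Path labels and the exchange of griddings -/

/-- The pairs of labels (letter and quarter) of points joined by a path of arcs inside `S`. -/
def pathLabels {A : Type*} (a : π.carrier → A) (S : Set π.carrier) (c : π.carrier → Quarter m n) :
    Set ((A × Quarter m n) × (A × Quarter m n)) :=
  {l | ∃ s ∈ S, ∃ t ∈ S, ReflTransGen (π.ArcOn S c) s t ∧ l = ((a s, c s), (a t, c t))}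

/-- The path labels of all griddings of `S`. -/
def griddingType {A : Type*} (M : Matrix (Fin m) (Fin n) SignType) (a : π.carrier → A)
    (S : Set π.carrier) : Set (Set ((A × Quarter m n) × (A × Quarter m n))) :=
  {R | ∃ c, IsGridding M π S c ∧ R = pathLabels a S c}

/-- The points `s` and `t` have the same relative position to `q`. -/
def Alike (π : Permutation) (s t q : π.carrier) : Prop :=
  (π.lt₁ s q ↔ π.lt₁ t q) ∧ (π.lt₁ q s ↔ π.lt₁ q t) ∧
    (π.lt₂ s q ↔ π.lt₂ t q) ∧ (π.lt₂ q s ↔ π.lt₂ q t)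

theorem Alike.arc_iff {s t q : π.carrier} (h : π.Alike s t q) {c d : π.carrier → Quarter m n}
    (hst : c s = d t) (hq : c q = d q) : π.Arc c s q ↔ π.Arc d t q := by
  unfold Arc
  rw [hst, hq, h.1, h.2.1, h.2.2.1, h.2.2.2]

theorem Alike.arc_iff' {s t q : π.carrier} (h : π.Alike s t q) {c d : π.carrier → Quarter m n}
    (hst : c s = d t) (hq : c q = d q) : π.Arc c q s ↔ π.Arc d q t := by
  unfold Arc
  rw [hst, hq, h.1, h.2.1, h.2.2.1, h.2.2.2]

theorem arc_congr {c d : π.carrier → Quarter m n} {x y : π.carrier} (hx : c x = d x)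
    (hy : c y = d y) : π.Arc c x y ↔ π.Arc d x y := by
  unfold Arc
  rw [hx, hy]

/-- Points of `Q` see a point of `P` or `P'` only through its label. A cycle meeting `Q` outside
`P'` would therefore become a cycle in `P ∪ Q`, once each excursion into `P'` is replaced by a path
in `P` with the same end labels. -/
theorem IsGridding.glue {A : Type*} {a : π.carrier → A} {P P' Q : Set π.carrier}
    {c c' d : π.carrier → Quarter m n} (h : IsGridding M π (P ∪ Q) c)
    (h' : IsGridding M π P' c') (hlab : pathLabels a P' c' ⊆ pathLabels a P c)
    (halike : ∀ s ∈ P, ∀ t ∈ P', ∀ q ∈ Q, a s = a t → π.Alike s t q)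
    (hdP : ∀ x ∈ P', d x = c' x) (hdQ : ∀ x ∈ Q, d x = c x) :
    IsGridding M π (P' ∪ Q) d := by
  have hpath : ∀ u ∈ P', ∀ v ∈ P', ReflTransGen (π.ArcOn P' c') u v →
      ∃ s ∈ P, ∃ t ∈ P, ReflTransGen (π.ArcOn P c) s t ∧ a s = a u ∧ c s = d u ∧
        a t = a v ∧ c t = d v := by
    intro u hu v hv huv
    obtain ⟨s, hs, t, ht, hst, heq⟩ := hlab ⟨u, hu, v, hv, huv, rfl⟩
    simp only [Prod.mk.injEq] at heq
    exact ⟨s, hs, t, ht, hst, heq.1.1.symm, by rw [hdP u hu]; exact heq.1.2.symm, heq.2.1.symm,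
      by rw [hdP v hv]; exact heq.2.2.symm⟩
  have hmatch : ∀ t ∈ P', ∃ s ∈ P, a s = a t ∧ c s = d t := by
    intro t ht
    obtain ⟨s, hs, -, -, -, h1, h2, -⟩ := hpath t ht t ht .refl
    exact ⟨s, hs, h1, h2⟩
  have hsub : ∀ x y, π.ArcOn P c x y → π.ArcOn (P ∪ Q) c x y :=
    fun x y hxy => ⟨Or.inl hxy.1, Or.inl hxy.2.1, hxy.2.2⟩
  refine ⟨?_, ?_, ?_, ?_⟩
  · rintro x (hx | hx)
    · rw [hdP x hx]; exact h'.fits x hx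
    · rw [hdQ x hx]; exact h.fits x (Or.inr hx)
  · rintro x (hx | hx) y (hy | hy) hxy
    · rw [hdP x hx, hdP y hy]; exact h'.mono₁ x hx y hy hxy
    · obtain ⟨s, hs, h1, h2⟩ := hmatch x hx
      rw [hdQ y hy, ← h2]
      exact h.mono₁ s (Or.inl hs) y (Or.inr hy) ((halike s hs x hx y hy h1).1.2 hxy)
    · obtain ⟨s, hs, h1, h2⟩ := hmatch y hy
      rw [hdQ x hx, ← h2]
      exact h.mono₁ x (Or.inr hx) s (Or.inl hs) ((halike s hs y hy x hx h1).2.1.2 hxy)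
    · rw [hdQ x hx, hdQ y hy]; exact h.mono₁ x (Or.inr hx) y (Or.inr hy) hxy
  · rintro x (hx | hx) y (hy | hy) hxy
    · rw [hdP x hx, hdP y hy]; exact h'.mono₂ x hx y hy hxy
    · obtain ⟨s, hs, h1, h2⟩ := hmatch x hx
      rw [hdQ y hy, ← h2]
      exact h.mono₂ s (Or.inl hs) y (Or.inr hy) ((halike s hs x hx y hy h1).2.2.1.2 hxy)
    · obtain ⟨s, hs, h1, h2⟩ := hmatch y hy
      rw [hdQ x hx, ← h2]
      exact h.mono₂ x (Or.inr hx) s (Or.inl hs) ((halike s hs y hy x hx h1).2.2.2.2 hxy)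
    · rw [hdQ x hx, hdQ y hy]; exact h.mono₂ x (Or.inr hx) y (Or.inr hy) hxy
  · have hP : ∀ {x y}, x ∈ P' → y ∈ P' → π.Arc d x y → π.ArcOn P' c' x y :=
      fun hx hy hxy => ⟨hx, hy, (arc_congr (hdP _ hx) (hdP _ hy)).1 hxy⟩
    -- Paths that start in `Q` are followed in `P ∪ Q`.
    have hfollow : ∀ q ∈ Q, ∀ v, TransGen (π.ArcOn (P' ∪ Q) d) q v →
        (v ∈ Q ∧ TransGen (π.ArcOn (P ∪ Q) c) q v) ∨
        (v ∈ P' ∧ ∃ u ∈ P', ReflTransGen (π.ArcOn P' c') u v ∧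
          ∀ s ∈ P, a s = a u → c s = d u → TransGen (π.ArcOn (P ∪ Q) c) q s) := by
      intro q hq v hv
      have hstart : ∀ q' ∈ Q, ∀ v, v ∈ P' → π.Arc d q' v → ∀ s ∈ P, a s = a v → c s = d v →
          π.ArcOn (P ∪ Q) c q' s := by
        intro q' hq' v hv hqv s hs h1 h2
        exact ⟨Or.inr hq', Or.inl hs,
          ((halike s hs v hv q' hq' h1).arc_iff' h2 (hdQ q' hq').symm).2 hqv⟩
      have hQQ : ∀ {x y}, x ∈ Q → y ∈ Q → π.Arc d x y → π.ArcOn (P ∪ Q) c x y :=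
        fun hx hy hxy => ⟨Or.inr hx, Or.inr hy, (arc_congr (hdQ _ hx) (hdQ _ hy)).1 hxy⟩
      induction hv with
      | single hqv =>
        obtain ⟨-, hv | hv, hqv⟩ := hqv
        · exact Or.inr ⟨hv, _, hv, .refl, fun s hs h1 h2 => .single (hstart q hq _ hv hqv s hs h1 h2)⟩
        · exact Or.inl ⟨hv, .single (hQQ hq hv hqv)⟩
      | tail _ hvw ih =>
        obtain ⟨-, hw | hw, hvw⟩ := hvw
        · rcases ih with ⟨hv, ih⟩ | ⟨hv, u, hu, huv, ih⟩
          · exact Or.inr ⟨hw, _, hw, .refl,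
              fun s hs h1 h2 => ih.tail (hstart _ hv _ hw hvw s hs h1 h2)⟩
          · exact Or.inr ⟨hw, u, hu, huv.tail (hP hv hw hvw), ih⟩
        · rcases ih with ⟨hv, ih⟩ | ⟨hv, u, hu, huv, ih⟩
          · exact Or.inl ⟨hw, ih.tail (hQQ hv hw hvw)⟩
          -- The excursion ends here, so both its end labels are known and a replacement path can be
          -- chosen. Until now its starting point had to stay arbitrary among those with the entry
          -- label.
          · obtain ⟨s, hs, t, ht, hst, h1, h2, h3, h4⟩ := hpath u hu _ hv huv
            refine Or.inl ⟨hw, ((ih s hs h1 h2).trans_left (ReflTransGen.mono hsub _ _ hst)).tail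
              ⟨Or.inl ht, Or.inr hw, ?_⟩⟩
            exact ((halike t ht _ hv _ hw h3).arc_iff h4 (hdQ _ hw).symm).2 hvw
    have hQ : ∀ q ∈ Q, q ∉ P' → ¬ TransGen (π.ArcOn (P' ∪ Q) d) q q := by
      intro q hq hq' hqq
      rcases hfollow q hq q hqq with ⟨-, h1⟩ | ⟨h1, -⟩
      · exact h.acyclic q h1
      · exact hq' h1
    intro x hx
    -- A cycle either stays in `P'` or meets a point of `Q \ P'`.
    have hstay : ∀ v, TransGen (π.ArcOn (P' ∪ Q) d) x v →
        (∃ q ∈ Q, q ∉ P' ∧ ReflTransGen (π.ArcOn (P' ∪ Q) d) x q ∧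
          ReflTransGen (π.ArcOn (P' ∪ Q) d) q v) ∨
        (v ∈ P' ∧ TransGen (π.ArcOn P' c') x v) := by
      intro v hv
      induction hv with
      | @single w hxv =>
        by_cases hx' : x ∈ P'
        · by_cases hv' : w ∈ P'
          · exact Or.inr ⟨hv', .single (hP hx' hv' hxv.2.2)⟩
          · exact Or.inl ⟨_, hxv.2.1.resolve_left hv', hv', .single hxv, .refl⟩
        · exact Or.inl ⟨x, hxv.1.resolve_left hx', hx', .refl, .single hxv⟩
      | @tail u w hxv hvw ih =>
        rcases ih with ⟨q, hq, hq', h1, h2⟩ | ⟨hv, ih⟩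
        · exact Or.inl ⟨q, hq, hq', h1, h2.tail hvw⟩
        · by_cases hw : w ∈ P'
          · exact Or.inr ⟨hw, ih.tail (hP hv hw hvw.2.2)⟩
          · exact Or.inl ⟨_, hvw.2.1.resolve_left hw, hw, (hxv.tail hvw).to_reflTransGen, .refl⟩
    rcases hstay x hx with ⟨q, hq, hq', h1, h2⟩ | ⟨-, h1⟩
    · exact hQ q hq hq' ((TransGen.trans_right h2 hx).trans_left h1)
    · exact h'.acyclic x h1

/-! ### Letters from a drawing with one point deleted -/

theorem alike_of_lt_iff {s t q : π.carrier} (hs : s ≠ q) (ht : t ≠ q)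
    (h₁ : π.lt₁ s q ↔ π.lt₁ t q) (h₂ : π.lt₂ s q ↔ π.lt₂ t q) : π.Alike s t q := by
  refine ⟨h₁, ?_, h₂, ?_⟩
  · rw [rel_swap_iff_not π.strictTotal₁ hs, rel_swap_iff_not π.strictTotal₁ ht, h₁]
  · rw [rel_swap_iff_not π.strictTotal₂ hs, rel_swap_iff_not π.strictTotal₂ ht, h₂]

/-- In a drawing, the relative position of `s` and `q` is determined by their quarters if `s` is
not farther from the centre of its cell than `q`. -/
theorem IsDrawing.alike {c : π.carrier → Quarter m n} {e : π.carrier → ℝ}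
    (h : IsDrawing M π c e) {s t q : π.carrier} (hs : s ≠ q) (ht : t ≠ q) (hst : c s = c t)
    (hsq : e s ≤ e q) (htq : e t ≤ e q) : π.Alike s t q := by
  have key₁ : ∀ {u}, u ≠ q → e u ≤ e q →
      (π.lt₁ u q ↔ xPos (c u) < xPos (c q) ∨ (xPos (c u) = xPos (c q) ∧ (c u).2.2.1)) := by
    intro u hu hle
    rcases lt_trichotomy (xPos (c u)) (xPos (c q)) with hlt | heq | hgt
    · simp only [hlt, true_or, iff_true]
      by_contra hn
      exact absurd (h.xPos_le ((rel_swap_iff_not π.strictTotal₁ hu).2 hn)) (by omega)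
    · have h1 := h.lt₁_iff_of_xPos_eq heq
      have h2 := h.lt₁_iff_of_xPos_eq heq.symm
      rw [rel_swap_iff_not π.strictTotal₁ hu, ← (eq_of_pos_eq heq).2, h1] at h2
      rw [h1]
      cases hb : (c u).2.2.1
      · simp [heq, hle]
      · simp only [hb, if_true, not_lt] at h2
        simp only [if_true, heq, lt_irrefl, and_self, or_true, iff_true]
        -- Equal distances would give two distinct points the same coordinate.
        exact lt_of_le_of_ne hle fun h3 => by simp [h3] at h2
    · constructor
      · intro h1
        exact absurd (h.xPos_le h1) (by omega)
      · intro h1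
        omega
  have key₂ : ∀ {u}, u ≠ q → e u ≤ e q →
      (π.lt₂ u q ↔ yPos (c u) < yPos (c q) ∨ (yPos (c u) = yPos (c q) ∧ (c u).2.2.2)) := by
    intro u hu hle
    rcases lt_trichotomy (yPos (c u)) (yPos (c q)) with hlt | heq | hgt
    · simp only [hlt, true_or, iff_true]
      by_contra hn
      exact absurd (h.yPos_le ((rel_swap_iff_not π.strictTotal₂ hu).2 hn)) (by omega)
    · have h1 := h.lt₂_iff_of_yPos_eq heq
      have h2 := h.lt₂_iff_of_yPos_eq heq.symm
      rw [rel_swap_iff_not π.strictTotal₂ hu, ← (eq_of_pos_eq heq).2, h1] at h2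
      rw [h1]
      cases hb : (c u).2.2.2
      · simp [heq, hle]
      · simp only [hb, if_true, not_lt] at h2
        simp only [if_true, heq, lt_irrefl, and_self, or_true, iff_true]
        exact lt_of_le_of_ne hle fun h3 => by simp [h3] at h2
    · constructor
      · intro h1
        exact absurd (h.yPos_le h1) (by omega)
      · intro h1
        omega
  refine alike_of_lt_iff hs ht ?_ ?_
  · rw [key₁ hs hsq, key₁ ht htq, hst]
  · rw [key₂ hs hsq, key₂ ht htq, hst]

/-- The letters which encode a one-point extension of a permutation in a geometric grid class:
`none` for the new point, and for the others the quarter and the position relative to the new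
point. -/
abbrev Letter (m n : ℕ) : Type := Option (Quarter m n × Prop × Prop)

theorem exists_letters {x : π.carrier} (hx : π.restrict {x}ᶜ ∈ Geom M) :
    ∃ (a : π.carrier → Letter m n) (e : π.carrier → ℝ), ∀ s t q, s ≠ q → t ≠ q → e s ≤ e q →
      e t ≤ e q → a s = a t → π.Alike s t q := by
  classical
  obtain ⟨c, e, h⟩ := mem_geom_iff_exists_isDrawing.1 hx
  refine ⟨fun y => if hy : y ≠ x then some (c ⟨y, hy⟩, π.lt₁ y x, π.lt₂ y x) else none,
    fun y => if hy : y ≠ x then e ⟨y, hy⟩ else 0, ?_⟩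
  intro s t q hs ht hsq htq hst
  by_cases hsx : s = x
  · by_cases htx : t = x
    · rw [hsx, htx]; exact ⟨Iff.rfl, Iff.rfl, Iff.rfl, Iff.rfl⟩
    · simp [hsx, htx] at hst
  by_cases htx : t = x
  · simp [hsx, htx] at hst
  simp only [ne_eq, hsx, htx, not_false_eq_true, dite_true, Option.some.injEq,
    Prod.mk.injEq] at hst hsq htq
  -- The deleted point has distance 0, so this case is a tie with points at centres; the two
  -- propositions in the letters settle it.
  by_cases hqx : q = x
  · subst hqx
    exact alike_of_lt_iff hs ht (iff_of_eq hst.2.1) (iff_of_eq hst.2.2)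
  · simp only [hqx, not_false_eq_true, dite_true] at hsq htq
    exact h.alike (s := ⟨s, hsx⟩) (t := ⟨t, htx⟩) (q := ⟨q, hqx⟩)
      (fun h => hs (congrArg Subtype.val h)) (fun h => ht (congrArg Subtype.val h)) hst.1 hsq htq

/-! ### Counting types and the pigeonhole argument -/

theorem card_gridding_types (m n : ℕ) :
    Nat.card (Set (Set ((Letter m n × Quarter m n) × (Letter m n × Quarter m n)))) =
      2 ^ 2 ^ ((16 * (m * n) + 1) * (4 * (m * n)) * ((16 * (m * n) + 1) * (4 * (m * n)))) := by
  classical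
  have hq : Fintype.card (Quarter m n) = 4 * (m * n) := by
    simp; ring
  have hl : Fintype.card (Letter m n) = 16 * (m * n) + 1 := by
    rw [Fintype.card_option, Fintype.card_prod, hq]
    simp; ring
  rw [Nat.card_eq_fintype_card, Fintype.card_set, Fintype.card_set, Fintype.card_prod,
    Fintype.card_prod, hl, hq]

theorem size_le_of_mem_basis_geom (hπ : π ∈ basis (Geom M)) :
    π.size ≤ 2 ^ 2 ^ ((16 * (m * n) + 1) * (4 * (m * n)) * ((16 * (m * n) + 1) * (4 * (m * n)))) := by
  classical
  by_contra! hlt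
  have := π.finite
  rw [← card_gridding_types] at hlt
  have htwo : 1 < π.size := by
    rw [card_gridding_types] at hlt
    exact (Nat.one_le_two_pow).trans_lt hlt
  have : Nontrivial π.carrier := (Finite.one_lt_card_iff_nontrivial).1 htwo
  obtain ⟨x, y, hxy⟩ := exists_pair_ne π.carrier
  have hx : π.restrict {x}ᶜ ∈ Geom M := restrict_mem_of_mem_basis hπ (x := x) (by simp)
  -- The quarter of a second point serves as default value off the gridded set.
  have : Nonempty (Quarter m n) := by
    obtain ⟨c, -⟩ := mem_geom_iff_exists_isDrawing.1 hx
    exact ⟨c ⟨y, hxy.symm⟩⟩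
  obtain ⟨a, e, ha⟩ := exists_letters hx
  let g : Fin π.size ≃ π.carrier := (Finite.equivFin π.carrier).symm
  let v : Fin π.size ≃ π.carrier := (Tuple.sort (e ∘ g)).trans g
  have hv : Monotone (e ∘ v) := Tuple.monotone_sort (e ∘ g)
  let P : Fin (π.size + 1) → Set π.carrier := fun i => {z | ((v.symm z : Fin _) : ℕ) < i}
  have hP : ∀ i, ∀ s ∈ P i, ∀ q ∉ P i, e s ≤ e q := by
    intro i s hs q hq
    have : v.symm s ≤ v.symm q := by
      simp only [P, Set.mem_ofPred_eq, not_lt] at hs hq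
      exact Fin.le_def.2 (hs.le.trans hq)
    simpa using hv this
  obtain ⟨i, j, hij, htype⟩ : ∃ i j : Fin (π.size + 1), i < j ∧
      griddingType M a (P i) = griddingType M a (P j) := by
    have hninj : ¬ Function.Injective fun i => griddingType M a (P i) := by
      intro hinj
      have := Nat.card_le_card_of_injective _ hinj
      rw [Nat.card_eq_fintype_card, Fintype.card_fin] at this
      omega
    simp only [Function.Injective, not_forall] at hninj
    obtain ⟨i, j, h, hne⟩ := hninj
    rcases lt_or_gt_of_ne hne with h' | h'
    · exact ⟨i, j, h', h⟩
    · exact ⟨j, i, h', h.symm⟩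
  have hsub : P i ⊆ P j := fun z hz => lt_trans (show _ < (i : ℕ) from hz) hij
  have hmem : π.restrict (P i ∪ (P j)ᶜ) ∈ Geom M := by
    -- The point with index `i` lies in `P j` but not in `P i`, so something is deleted.
    refine restrict_mem_of_mem_basis hπ (x := v ⟨i, by omega⟩) ?_
    simp [P]
    exact hij
  obtain ⟨c, hc⟩ := exists_isGridding_of_restrict_mem_geom hmem
  have hcP : IsGridding M π (P i) c :=
    ⟨fun s hs => hc.fits s (Or.inl hs), fun s hs t ht => hc.mono₁ s (Or.inl hs) t (Or.inl ht),
      fun s hs t ht => hc.mono₂ s (Or.inl hs) t (Or.inl ht), fun s hs => hc.acyclic s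
        (TransGen.mono (fun _ _ h => ⟨Or.inl h.1, Or.inl h.2.1, h.2.2⟩) _ _ hs)⟩
  obtain ⟨c', hc', hlab⟩ : pathLabels a (P i) c ∈ griddingType M a (P j) :=
    htype ▸ ⟨c, hcP, rfl⟩
  have hglue : IsGridding M π (P j ∪ (P j)ᶜ) fun z => if z ∈ P j then c' z else c z :=
    hc.glue hc' hlab.ge
      (fun s hs t ht q hq hst => ha s t q (fun h => hq (h ▸ hsub hs)) (fun h => hq (h ▸ ht))
        (hP j s (hsub hs) q hq) (hP j t ht q hq) hst)
      (fun z hz => if_pos hz) (fun z hz => if_neg hz)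
  rw [Set.union_compl_self] at hglue
  exact hπ.1 hglue.mem_geom

end Permutation

/-! ### Computability of the bound -/

theorem primrec_two_pow : Primrec fun k : ℕ => 2 ^ k :=
  (Primrec.nat_rec₁ 1 (Primrec.nat_mul.comp₂ Primrec₂.right (Primrec₂.const 2))).of_eq fun k => by
    induction k with
    | zero => rfl
    | succ k ih => simp only [pow_succ, ← ih]

theorem mainTheorem4 :
    ∃ f : ℕ → ℕ, Computable f ∧
      ∀ (m n : ℕ) (M : Matrix (Fin m) (Fin n) SignType),
        ∀ π ∈ Permutation.basis (Geom M), π.size ≤ f (m * n) := by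
  refine ⟨fun k => 2 ^ 2 ^ ((16 * k + 1) * (4 * k) * ((16 * k + 1) * (4 * k))), ?_,
    fun m n M π hπ => Permutation.size_le_of_mem_basis_geom hπ⟩
  have h : Primrec fun k : ℕ => (16 * k + 1) * (4 * k) :=
    Primrec.nat_mul.comp
      (Primrec.nat_add.comp (Primrec.nat_mul.comp (Primrec.const 16) Primrec.id) (Primrec.const 1))
      (Primrec.nat_mul.comp (Primrec.const 4) Primrec.id)
  exact (primrec_two_pow.comp (primrec_two_pow.comp (Primrec.nat_mul.comp h h))).to_comp
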